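/- Let $R$ be a commutative noetherian local ring of depth $t$ (the least $i$ with $\operatorname{Ext}^i_R(k,R)\neq 0$, $k$ the residue field), and let $M$ be a finitely generated $R$-module; write $(-)^*=\operatorname{Hom}_R(-,R)$. For a finitely generated module $X$ with a resolution $\cdots\to P_1\to P_0\to X\to 0$ by finitely generated projective modules, put $\Omega^nX=\operatorname{Im}(P_n\to P_{n-1})$ ($\Omega^0X=X$), $\operatorname{Tr}\Omega^nX=\operatorname{Coker}(P_n^*\to P_{n+1}^*)$ and, in particular, $\operatorname{Tr}X=\operatorname{Coker}(P_0^*\to P_1^*)$; these are unique up to projective summands, and $f\colon X\to Y$ induces $\operatorname{Tr}f\colon\operatorname{Tr}Y\to\operatorname{Tr}X$, unique up to maps factoring through projective modules. Say that $f$ satisfies $(\mathrm T_1)$ if $\operatorname{Ext}^1_R(\operatorname{Tr}f,R)\colon\operatorname{Ext}^1_R(\operatorname{Tr}X,R)\to\operatorname{Ext}^1_R(\operatorname{Tr}Y,R)$ is injective, and that $f$ is represented by monomorphisms if $\binom{f}{s}\colon X\to Y\oplus F$ is injective for some homomorphism $s\colon X\to F$ with $F$ finitely generated projective. Let $P_\bullet$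 be a resolution of $M$ by finitely generated projective modules. For $n\ge 0$ let $Q^n_\bullet$ be such a resolution of $\operatorname{Tr}\Omega^nM=\operatorname{Coker}(P_n^*\to P_{n+1}^*)$, and put $\mathrm J_n^2M=\operatorname{Tr}\Omega^n\operatorname{Tr}\Omega^nM=\operatorname{Coker}((Q^n_n)^*\to(Q^n_{n+1})^*)$. A chain map from $P_0^*\to P_1^*\to\cdots\to P_{n+1}^*$ to $Q^n_{n+1}\to Q^n_n\to\cdots\to Q^n_0$ that lifts the identity of $\operatorname{Tr}\Omega^nM$ induces, by dualizing, the natural map $\psi^n_M\colon\mathrm J_n^2M\to\operatorname{Coker}(P_1\to P_0)=M$. For $n\ge1$, a chain map from $\cdots\to Q^{n-1}_1\to Q^{n-1}_0\to P_{n+1}^*$ (the last map being the composite $Q^{n-1}_0\to\operatorname{Tr}\Omega^{n-1}M\to P_{n+1}^*$) to $\cdots\to Q^n_2\to Q^n_1\to Q^n_0$ that lifts the identity of $\operatorname{Tr}\Omega^nM$ induces, by dualizing $Q^{n-1}_n\to Q^n_{n+1}$, the natural map $\psi^{n,n-1}_M\colon\mathrm J_n^2M\to\mathrm J_{n-1}^2M$.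 Suppose that $\operatorname{Ext}^i_R(M,R)$ has finite length for all $1\le i\le t$. Then, for every choice of the resolutions and chain maps above, the following hold. (1) The maps $\psi^{i,i-1}_M\colon\mathrm J_i^2M\to\mathrm J_{i-1}^2M$ and $\psi^i_M\colon\mathrm J_i^2M\to M$ satisfy $(\mathrm T_1)$ for all $1\le i\le t$. (2) If $\operatorname{Ext}^{t+1}_R(M,R)$ also has finite length, then the following are equivalent: $\operatorname{Ext}^{t+1}_R(M,R)=0$; $\psi^{t+1,t}_M$ satisfies $(\mathrm T_1)$; $\psi^{t+1}_M$ satisfies $(\mathrm T_1)$; $\psi^{t+1,t}_M$ is represented by monomorphisms; $\psi^{t+1}_M$ is represented by monomorphisms. -/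

import Mathlib

open CategoryTheory CategoryTheory.Abelian

universe u

namespace StableModule

variable {R : Type u} [CommRing R]

/-- A resolution of `Z` by finitely generated projective modules. -/
structure FGResolution (Z : ModuleCat.{u} R) extends ProjectiveResolution Z where
  finite : ∀ n, Module.Finite R (complex.X n)

namespace FGResolution

variable {Z : ModuleCat.{u} R} (P : FGResolution Z)

/-- The `n`-th module of the resolution. -/
abbrev obj (n : ℕ) : ModuleCat.{u} R := P.complex.X n

instance (n : ℕ) : Module.Finite R (P.obj n) := P.finite n

instance (n : ℕ) : Module.Projective R (P.obj n) :=
  (IsProjective.iff_projective (P.obj n)).2 (P.projective n)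

/-- The differential `∂ₙ₊₁ : Pₙ₊₁ → Pₙ`. -/
noncomputable def d (n : ℕ) : P.obj (n + 1) →ₗ[R] P.obj n :=
  (P.complex.d (n + 1) n).hom

/-- The augmentation `∂₀ : P₀ → Z`. -/
noncomputable def aug : P.obj 0 →ₗ[R] Z :=
  let π₀ : P.obj 0 ⟶ Z := P.π.f 0
  π₀.hom

lemma d_comp_d (n : ℕ) : P.d n ∘ₗ P.d (n + 1) = 0 := by
  have h := P.complex.d_comp_d (n + 2) (n + 1) n
  exact congrArg ModuleCat.Hom.hom h

lemma aug_comp_d : P.aug ∘ₗ P.d 0 = 0 := by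
  have h := P.complex_d_comp_π_f_zero
  exact congrArg ModuleCat.Hom.hom h

/-- The transposed differential `∂ₙ₊₁* : Pₙ* → Pₙ₊₁*`. -/
noncomputable def codiff (n : ℕ) :
    Module.Dual R (P.obj n) →ₗ[R] Module.Dual R (P.obj (n + 1)) :=
  (P.d n).dualMap

lemma codiff_comp_codiff (n : ℕ) : P.codiff (n + 1) ∘ₗ P.codiff n = 0 := by
  ext φ x
  have h := LinearMap.congr_fun (P.d_comp_d n) x
  simp only [LinearMap.comp_apply, LinearMap.zero_apply] at h
  simp [codiff, LinearMap.dualMap_apply, h]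

/-- The module `Tr Ωⁿ Z = Cok (∂ₙ₊₁* : Pₙ* → Pₙ₊₁*)`: the truncation of `P` in degrees `≥ n` is a
projective resolution of `Ωⁿ Z = Im ∂ₙ`, and the transpose is computed from its first
differential `∂ₙ₊₁`. For `n = 0` this is `Tr Z`. -/
abbrev TrSyz (n : ℕ) : Type u :=
  Module.Dual R (P.obj (n + 1)) ⧸ LinearMap.range (P.codiff n)

/-- The projection `Pₙ₊₁* → Tr Ωⁿ Z`. -/
noncomputable def toTrSyz (n : ℕ) : Module.Dual R (P.obj (n + 1)) →ₗ[R] P.TrSyz n :=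
  (LinearMap.range (P.codiff n)).mkQ

/-- The map `Tr Ωⁿ Z → Pₙ₊₂*` induced by `∂ₙ₊₂* : Pₙ₊₁* → Pₙ₊₂*`. Its cokernel is
`Tr Ωⁿ⁺¹ Z`. -/
noncomputable def ofTrSyz (n : ℕ) : P.TrSyz n →ₗ[R] Module.Dual R (P.obj (n + 2)) :=
  (LinearMap.range (P.codiff n)).liftQ (P.codiff (n + 1)) (by
    rw [LinearMap.range_le_ker_iff]
    exact P.codiff_comp_codiff n)

end FGResolution

section Transpose

variable {X Y : Type u} [AddCommGroup X] [Module R X] [AddCommGroup Y] [Module R Y]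

/-- A chain map between resolutions of `X` and `Y` lifting a homomorphism `f : X → Y`. -/
structure LiftOf (f : X →ₗ[R] Y) (P : FGResolution (ModuleCat.of R X))
    (Q : FGResolution (ModuleCat.of R Y)) where
  map : ∀ k, P.obj k →ₗ[R] Q.obj k
  aug_comp : Q.aug ∘ₗ map 0 = f ∘ₗ P.aug
  d_comp : ∀ k, Q.d k ∘ₗ map (k + 1) = map k ∘ₗ P.d k

/-- The homomorphism `Tr f : Tr Y → Tr X` induced by `f₁* : Q₁* → P₁*`. -/
noncomputable def LiftOf.tr {f : X →ₗ[R] Y} {P : FGResolution (ModuleCat.of R X)}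
    {Q : FGResolution (ModuleCat.of R Y)} (a : LiftOf f P Q) : Q.TrSyz 0 →ₗ[R] P.TrSyz 0 :=
  Submodule.mapQ _ _ (a.map 1).dualMap (by
    rintro _ ⟨φ, rfl⟩
    refine ⟨(a.map 0).dualMap φ, ?_⟩
    ext x
    have h := LinearMap.congr_fun (a.d_comp 0) x
    simp only [LinearMap.comp_apply] at h
    simp [FGResolution.codiff, LinearMap.dualMap_apply, h])

/-- The map `Extⁱ(g, R) : Extⁱ(Y, R) → Extⁱ(X, R)` induced by `g : X → Y`. -/
noncomputable def extMap (g : X →ₗ[R] Y) (i : ℕ) :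
    Ext (ModuleCat.of R Y) (ModuleCat.of R R) i → Ext (ModuleCat.of R X) (ModuleCat.of R R) i :=
  fun e => (Ext.mk₀ (ModuleCat.ofHom g)).comp e (zero_add i)

/-- The condition `(Tₙ)` for `f : X → Y`: the map `Extⁱ(Tr f, R) : Extⁱ(Tr X, R) → Extⁱ(Tr Y, R)`
is bijective for `1 ≤ i ≤ n - 1` and injective for `i = n`; every `f` satisfies `(T₀)`.
As `Tr f` depends on the chosen resolutions and on the chosen lift of `f` (but only up to stable
isomorphism), the condition is required for all choices. -/
def SatisfiesT (n : ℕ) (f : X →ₗ[R] Y) : Prop :=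
  ∀ (P : FGResolution (ModuleCat.of R X)) (Q : FGResolution (ModuleCat.of R Y))
    (a : LiftOf f P Q),
    (∀ i, 1 ≤ i → i < n → Function.Bijective (extMap a.tr i)) ∧
    (1 ≤ n → Function.Injective (extMap a.tr n))

/-- `f : X → Y` is represented by monomorphisms: there are a finitely generated projective module
`F` and `t : X → F` such that `(f, t) : X → Y ⊕ F` is injective. -/
def IsRepresentedByMono (f : X →ₗ[R] Y) : Prop :=
  ∃ (F : ModuleCat.{u} R) (_ : Module.Finite R F) (_ : Module.Projective R F) (t : X →ₗ[R] F),
    Function.Injective (f.prod t)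

end Transpose

section Psi

variable {M : Type u} [AddCommGroup M] [Module R M] (P : FGResolution (ModuleCat.of R M))

/-- For a resolution `Q` of `Tr Ωⁿ M`, the module `Jₙ² M = Tr Ωⁿ (Tr Ωⁿ M)`, that is, the cokernel
of `Qₙ* → Qₙ₊₁*`. -/
abbrev J {P : FGResolution (ModuleCat.of R M)} {n : ℕ}
    (Q : FGResolution (ModuleCat.of R (P.TrSyz n))) : Type u := Q.TrSyz n

/-- A chain map, lifting the identity of `Tr Ωⁿ M`, from the complex
`P₀* → P₁* → ⋯ → Pₙ₊₁* → Tr Ωⁿ M` to a resolution `Q` of `Tr Ωⁿ M`.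
The module `Pⱼ*` sits in degree `k` with `j + k = n + 1`. -/
structure PsiLift {n : ℕ} (Q : FGResolution (ModuleCat.of R (P.TrSyz n))) where
  map : ∀ j k, j + k = n + 1 → (Module.Dual R (P.obj j) →ₗ[R] Q.obj k)
  aug_comp : Q.aug ∘ₗ map (n + 1) 0 rfl = P.toTrSyz n
  d_comp : ∀ j k (h : j + (k + 1) = n + 1),
    Q.d k ∘ₗ map j (k + 1) h = map (j + 1) k (by omega) ∘ₗ P.codiff j

variable {P}

/-- The map `Qₙ₊₁* → P₀** ≅ P₀ → M` obtained from the dual of `P₀* → Qₙ₊₁`. -/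
noncomputable def PsiLift.prePsi {n : ℕ} {Q : FGResolution (ModuleCat.of R (P.TrSyz n))}
    (f : PsiLift P Q) : Module.Dual R (Q.obj (n + 1)) →ₗ[R] M :=
  P.aug ∘ₗ (Module.evalEquiv R (P.obj 0)).symm.toLinearMap ∘ₗ
    (f.map 0 (n + 1) (zero_add _)).dualMap

/-- The natural map `ψⁿ : Jₙ² M → M`, induced on cokernels by the commutative square from
`Qₙ* → Qₙ₊₁*` to `P₁ → P₀`. -/
noncomputable def PsiLift.psi {n : ℕ} {Q : FGResolution (ModuleCat.of R (P.TrSyz n))}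
    (f : PsiLift P Q) : J Q →ₗ[R] M :=
  (LinearMap.range (Q.codiff n)).liftQ f.prePsi (by
    rintro _ ⟨χ, rfl⟩
    set p := (Module.evalEquiv R (P.obj 1)).symm ((f.map 1 n (add_comm 1 n)).dualMap χ) with hp
    have key : (f.map 0 (n + 1) (zero_add _)).dualMap (Q.codiff n χ)
        = Module.evalEquiv R (P.obj 0) (P.d 0 p) := by
      ext φ
      have h := LinearMap.congr_fun (f.d_comp 0 n (zero_add _)) φ
      simp only [LinearMap.comp_apply] at h
      have h2 : Module.evalEquiv R (P.obj 1) p (P.codiff 0 φ)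
          = χ (f.map 1 n (add_comm 1 n) (P.codiff 0 φ)) := by
        rw [hp, LinearEquiv.apply_symm_apply]
        rfl
      change χ (Q.d n (f.map 0 (n + 1) (zero_add _) φ)) = φ (P.d 0 p)
      rw [h]
      exact h2.symm
    rw [LinearMap.mem_ker]
    change P.aug ((Module.evalEquiv R (P.obj 0)).symm
      ((f.map 0 (n + 1) (zero_add _)).dualMap (Q.codiff n χ))) = 0
    rw [key, LinearEquiv.symm_apply_apply]
    exact LinearMap.congr_fun P.aug_comp_d p)

variable (P)

/-- For resolutions `Q` of `Tr Ωᵐ M` and `Q'` of `Tr Ωᵐ⁺¹ M`, a chain map, lifting the identity of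
`Tr Ωᵐ⁺¹ M`, from the complex `⋯ → Q₁ → Q₀ → Pₘ₊₂* → Tr Ωᵐ⁺¹ M` to
`⋯ → Q'₂ → Q'₁ → Q'₀ → Tr Ωᵐ⁺¹ M`. -/
structure PsiStepLift {m : ℕ} (Q : FGResolution (ModuleCat.of R (P.TrSyz m)))
    (Q' : FGResolution (ModuleCat.of R (P.TrSyz (m + 1)))) where
  start : Module.Dual R (P.obj (m + 2)) →ₗ[R] Q'.obj 0
  map : ∀ k, Q.obj k →ₗ[R] Q'.obj (k + 1)
  aug_comp : Q'.aug ∘ₗ start = P.toTrSyz (m + 1)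
  d_comp_zero : Q'.d 0 ∘ₗ map 0 = start ∘ₗ P.ofTrSyz m ∘ₗ Q.aug
  d_comp_succ : ∀ k, Q'.d (k + 1) ∘ₗ map (k + 1) = map k ∘ₗ Q.d k

variable {P}

/-- The natural map `ψᵐ⁺¹'ᵐ : Jₘ₊₁² M → Jₘ² M`, induced on cokernels by the commutative square from
`Q'ₘ₊₁* → Q'ₘ₊₂*` to `Qₘ* → Qₘ₊₁*`. -/
noncomputable def PsiStepLift.psi {m : ℕ} {Q : FGResolution (ModuleCat.of R (P.TrSyz m))}
    {Q' : FGResolution (ModuleCat.of R (P.TrSyz (m + 1)))} (g : PsiStepLift P Q Q') :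
    J Q' →ₗ[R] J Q :=
  Submodule.mapQ _ _ (g.map (m + 1)).dualMap (by
    rintro _ ⟨χ, rfl⟩
    refine ⟨(g.map m).dualMap χ, ?_⟩
    ext x
    have h := LinearMap.congr_fun (g.d_comp_succ m) x
    simp only [LinearMap.comp_apply] at h
    simp [FGResolution.codiff, LinearMap.dualMap_apply, h])

end Psi

/-- The depth of a module `M` over a local ring `R` with residue field `k`: the infimum of the
integers `i` with `Extⁱ(k, M) ≠ 0`. -/
noncomputable def depth (R : Type u) [CommRing R] [IsLocalRing R]
    (M : Type u) [AddCommGroup M] [Module R M] : ℕ∞ :=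
  sInf {a : ℕ∞ | ∃ i : ℕ, a = i ∧
    Nontrivial (Ext (ModuleCat.of R (IsLocalRing.ResidueField R)) (ModuleCat.of R M) i)}

end StableModule

/-! Both properties in the theorem are one elementary condition. `Ext¹(Tr X, R)` is the kernel of
the biduality map `X → X**`, naturally in `X`. So `(T₁)` for `f` says that `f` is injective on this
kernel, and so does being represented by monomorphisms (`satisfiesT_one_iff`,
`isRepresentedByMono_iff`).

The bidual kernel of `Jₘ₊₁² M` is `Extᵐ⁺²(Tr Ωᵐ⁺¹ M, R)`, which shifts to `Extᵐ⁺¹(N, R)`, where `N`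
is the image of `Tr Ωᵐ M → Pₘ₊₂*`. There `ψᵐ⁺¹'ᵐ` becomes the map induced by `Tr Ωᵐ M → N`
(`injectiveOnBidualKer_psi_iff`). The kernel of `Tr Ωᵐ M → N` is `E = Extᵐ⁺¹(M, R)`, so the map is
injective as soon as `Extᵐ(E, R) = 0`. That holds if `E` has finite length and `m < t`, by the
definition of depth.

For `m = t` the restriction `Extᵗ(Tr Ωᵗ M, R) → Extᵗ(E, R)` is zero
(`extMap_subtype_kerOfTrSyz_eq_zero`), so injectivity forces `Extᵗ(E, R) = 0`. A nonzero `E` of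
finite length surjects onto `k`, and then `Extᵗ(k, R) ≠ 0` embeds in `Extᵗ(E, R)`; hence `E = 0`.

Finally, `ψᵐ⁺¹` agrees with `ψᵐ ∘ ψᵐ⁺¹'ᵐ` on the bidual kernel, by uniqueness of comparison maps up
to homotopy, and `ψ⁰` is injective there. This carries the results from `ψᵐ⁺¹'ᵐ` to `ψᵐ⁺¹`. -/

namespace StableModule

variable {R : Type u} [CommRing R]

/-! ### Resolutions as exact sequences, syzygies, cocycle classes -/

namespace FGResolution

section Exactness

variable {Z : ModuleCat.{u} R} (P : FGResolution Z)

lemma aug_surjective : Function.Surjective P.aug :=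
  (ModuleCat.epi_iff_surjective (P.π.f 0)).1 inferInstance

lemma exact_d_aug : Function.Exact (P.d 0) P.aug :=
  (ShortComplex.ShortExact.moduleCat_exact_iff_function_exact _).1 P.exact₀

lemma exact_d_d (n : ℕ) : Function.Exact (P.d (n + 1)) (P.d n) :=
  (ShortComplex.ShortExact.moduleCat_exact_iff_function_exact _).1 (P.exact_succ n)

end Exactness

section OfExact

variable {Z : ModuleCat.{u} R} (X : ℕ → ModuleCat.{u} R) (d : ∀ n, X (n + 1) →ₗ[R] X n)
  (ε : X 0 →ₗ[R] Z)
  (hε : Function.Surjective ε) (h₀ : Function.Exact (d 0) ε)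
  (h : ∀ n, Function.Exact (d (n + 1)) (d n))

/-- The chain complex attached to an exact sequence of modules. -/
noncomputable def complexOfExact : ChainComplex (ModuleCat.{u} R) ℕ :=
  ChainComplex.of X (fun n => ModuleCat.ofHom (d n)) fun n => by
    ext x
    exact (h n).apply_apply_eq_zero x

lemma complexOfExact_d (n : ℕ) :
    (complexOfExact X d h).d (n + 1) n = ModuleCat.ofHom (d n) :=
  ChainComplex.of_d X (fun n => ModuleCat.ofHom (d n)) n

variable [∀ n, Module.Finite R (X n)] [∀ n, Module.Projective R (X n)]

/-- The resolution attached to an exact sequence of finitely generated projective modules. -/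
noncomputable def ofExact : FGResolution Z where
  complex := complexOfExact X d h
  projective n := (IsProjective.iff_projective (X n)).1 inferInstance
  finite n := inferInstanceAs (Module.Finite R (X n))
  π := (ChainComplex.toSingle₀Equiv _ _).symm ⟨ModuleCat.ofHom ε, by
    rw [complexOfExact_d]
    ext x
    exact h₀.apply_apply_eq_zero x⟩
  quasiIso := ⟨fun n => by
    cases n with
    | zero =>
      rw [ChainComplex.quasiIsoAt₀_iff, ShortComplex.quasiIso_iff_of_zeros']
      · refine (ShortComplex.exact_and_epi_g_iff_of_iso ?_).2
          ⟨(?_ : (ShortComplex.mk (ModuleCat.ofHom (d 0)) (ModuleCat.ofHom ε) ?_).Exact), ?_⟩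
        · exact ShortComplex.isoMk (Iso.refl _) (Iso.refl _) (Iso.refl _)
            (by simp [complexOfExact_d]; rfl) (by simp; rfl)
        · ext x
          exact h₀.apply_apply_eq_zero x
        · exact (ShortComplex.ShortExact.moduleCat_exact_iff_function_exact _).2 h₀
        · exact (ModuleCat.epi_iff_surjective _).2 hε
      all_goals rfl
    | succ n =>
      rw [quasiIsoAt_iff_exactAt']
      · rw [HomologicalComplex.exactAt_iff' _ (n + 1 + 1) (n + 1) n (by simp) (by simp)]
        refine (ShortComplex.ShortExact.moduleCat_exact_iff_function_exact _).2 ?_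
        change Function.Exact ((complexOfExact X d h).d (n + 2) (n + 1)).hom
          ((complexOfExact X d h).d (n + 1) n).hom
        rw [complexOfExact_d, complexOfExact_d]
        exact h n
      · apply ChainComplex.exactAt_succ_single_obj⟩

lemma ofExact_d (n : ℕ) : (ofExact X d ε hε h₀ h).d n = d n :=
  congrArg ModuleCat.Hom.hom (complexOfExact_d X d h n)

lemma ofExact_aug : (ofExact X d ε hε h₀ h).aug = ε := by
  unfold aug ofExact
  simp
  rfl

end OfExact

end FGResolution

namespace FGResolution

/-- Deleting the first term of a resolution gives a resolution of the first syzygy. -/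
noncomputable def syzygy {Z : ModuleCat.{u} R} (P : FGResolution Z) :
    FGResolution (ModuleCat.of R (LinearMap.ker P.aug)) :=
  ofExact (fun n => P.obj (n + 1)) (fun n => P.d (n + 1))
    ((P.d 0).codRestrict (LinearMap.ker P.aug) P.exact_d_aug.apply_apply_eq_zero)
    (by
      rintro ⟨x, hx⟩
      obtain ⟨y, rfl⟩ := (P.exact_d_aug x).1 hx
      exact ⟨y, rfl⟩)
    (fun x => Subtype.ext_iff.trans (P.exact_d_d 0 x))
    (fun n => P.exact_d_d (n + 1))

section Syzygy

variable {Z : ModuleCat.{u} R} (P : FGResolution Z)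

lemma syzygy_d (n : ℕ) : P.syzygy.d n = P.d (n + 1) := ofExact_d ..

lemma syzygy_aug : P.syzygy.aug =
    (P.d 0).codRestrict (LinearMap.ker P.aug) P.exact_d_aug.apply_apply_eq_zero := ofExact_aug ..

lemma syzygy_aug_apply (x : P.obj 1) :
    P.syzygy.aug x = ⟨P.d 0 x, P.exact_d_aug.apply_apply_eq_zero x⟩ :=
  LinearMap.congr_fun P.syzygy_aug x

end Syzygy

section Existence

variable [IsNoetherianRing R]

/-- A finitely generated module, with a surjection from a free module of finite rank. -/
structure FiniteCover (R : Type u) [CommRing R] where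
  carrier : ModuleCat.{u} R
  finite : Module.Finite R carrier
  rank : ℕ
  cover : (Fin rank → R) →ₗ[R] carrier
  surjective : Function.Surjective cover

/-- A chosen cover of a finitely generated module. -/
noncomputable def finiteCover (Z : ModuleCat.{u} R) [hZ : Module.Finite R Z] : FiniteCover R where
  carrier := Z
  finite := hZ
  rank := (Module.Finite.exists_fin' R Z).choose
  cover := (Module.Finite.exists_fin' R Z).choose_spec.choose
  surjective := (Module.Finite.exists_fin' R Z).choose_spec.choose_spec

/-- Iterated kernels of chosen covers. -/
noncomputable def iteratedCover (Z : ModuleCat.{u} R) [Module.Finite R Z] : ℕ → FiniteCover R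
  | 0 => finiteCover Z
  | n + 1 => finiteCover (ModuleCat.of R (LinearMap.ker (iteratedCover Z n).cover))

/-- Over a noetherian ring each kernel is again finitely generated, so free covers can be chosen one
after another and spliced. -/
lemma nonempty_of_finite (Z : ModuleCat.{u} R) [Module.Finite R Z] :
    Nonempty (FGResolution Z) := by
  let c := iteratedCover Z
  let p : ∀ n, (Fin (c (n + 1)).rank → R) →ₗ[R] LinearMap.ker (c n).cover :=
    fun n => (c (n + 1)).cover
  have hp : ∀ n, Function.Surjective (p n) := fun n => (c (n + 1)).surjective
  have key : ∀ n, Function.Exact ((LinearMap.ker (c n).cover).subtype ∘ₗ p n) (c n).cover := by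
    intro n x
    constructor
    · intro hx
      obtain ⟨y, hy⟩ := hp n ⟨x, hx⟩
      exact ⟨y, congrArg Subtype.val hy⟩
    · rintro ⟨y, rfl⟩
      exact (p n y).2
  refine ⟨ofExact (fun n => ModuleCat.of R (Fin (c n).rank → R))
    (fun n => (LinearMap.ker (c n).cover).subtype ∘ₗ p n) (c 0).cover (c 0).surjective
    (key 0) fun n x => ?_⟩
  rw [← key (n + 1) x]
  change ((p n x : LinearMap.ker (c n).cover) : Fin (c n).rank → R) = 0 ↔ p n x = 0
  exact Submodule.coe_eq_zero

end Existence

/-- The class in `Extⁿ(Z, R)` of an `n`-cocycle. -/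
noncomputable def extClass {Z : ModuleCat.{u} R} (P : FGResolution Z) {n : ℕ}
    (φ : P.obj n →ₗ[R] R) (h : φ ∘ₗ P.d n = 0) : Ext Z (ModuleCat.of R R) n :=
  P.extMk (Y := ModuleCat.of R R) (ModuleCat.ofHom φ) (n + 1) rfl (ModuleCat.hom_ext h)

section ExtClass

variable {Z : ModuleCat.{u} R} (P : FGResolution Z) {n : ℕ}

lemma exists_extClass_eq (e : Ext Z (ModuleCat.of R R) n) :
    ∃ (φ : P.obj n →ₗ[R] R) (h : φ ∘ₗ P.d n = 0), P.extClass φ h = e := by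
  obtain ⟨φ, h, rfl⟩ := P.extMk_surjective e (n + 1) rfl
  exact ⟨φ.hom, congrArg ModuleCat.Hom.hom h, rfl⟩

lemma extClass_eq_zero_iff (φ : P.obj (n + 1) →ₗ[R] R) (h : φ ∘ₗ P.d (n + 1) = 0) :
    P.extClass φ h = 0 ↔ ∃ χ : P.obj n →ₗ[R] R, χ ∘ₗ P.d n = φ := by
  refine (P.extMk_eq_zero_iff _ _ _ _ n rfl).trans ⟨?_, ?_⟩
  · rintro ⟨χ, hχ⟩
    exact ⟨χ.hom, congrArg ModuleCat.Hom.hom hχ⟩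
  · rintro ⟨χ, hχ⟩
    exact ⟨ModuleCat.ofHom χ, ModuleCat.hom_ext hχ⟩

lemma extClass_add (φ ψ : P.obj n →ₗ[R] R) (hφ : φ ∘ₗ P.d n = 0) (hψ : ψ ∘ₗ P.d n = 0) :
    P.extClass (φ + ψ) (by rw [LinearMap.add_comp, hφ, hψ, add_zero]) =
      P.extClass φ hφ + P.extClass ψ hψ :=
  (P.add_extMk _ _ _ _ _ _).symm

lemma extClass_smul (r : R) (φ : P.obj n →ₗ[R] R) (hφ : φ ∘ₗ P.d n = 0) :
    P.extClass (r • φ) (by rw [LinearMap.smul_comp, hφ, smul_zero]) = r • P.extClass φ hφ := by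
  rw [Ext.smul_eq_comp_mk₀]
  refine Eq.trans ?_ (P.extMk_comp_mk₀ _ _ _ _ _).symm
  congr 1

end ExtClass

end FGResolution

/-! ### Chain maps and their effect on cocycle classes -/

section Lift

variable {X Y : Type u} [AddCommGroup X] [Module R X] [AddCommGroup Y] [Module R Y]
  {f : X →ₗ[R] Y} {P : FGResolution (ModuleCat.of R X)} {Q : FGResolution (ModuleCat.of R Y)}

lemma LiftOf.nonempty (f : X →ₗ[R] Y) (P : FGResolution (ModuleCat.of R X))
    (Q : FGResolution (ModuleCat.of R Y)) : Nonempty (LiftOf f P Q) := by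
  let φ := ProjectiveResolution.lift (ModuleCat.ofHom f) P.toProjectiveResolution
    Q.toProjectiveResolution
  refine ⟨⟨fun k => (φ.f k).hom, ?_, fun k => ?_⟩⟩
  · have h := ProjectiveResolution.lift_commutes_zero (ModuleCat.ofHom f) P.toProjectiveResolution
      Q.toProjectiveResolution
    exact congrArg ModuleCat.Hom.hom h
  · exact congrArg ModuleCat.Hom.hom (φ.comm (k + 1) k)

/-- The underlying morphism of projective resolutions. -/
noncomputable def LiftOf.toHom (a : LiftOf f P Q) :
    ProjectiveResolution.Hom P.toProjectiveResolution Q.toProjectiveResolution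
      (ModuleCat.ofHom f) where
  hom :=
    { f k := ModuleCat.ofHom (a.map k)
      comm' := by
        rintro _ j rfl
        exact ModuleCat.hom_ext (a.d_comp j) }
  hom_f_zero_comp_π_f_zero := ModuleCat.hom_ext a.aug_comp

lemma LiftOf.extMap_extClass (a : LiftOf f P Q) {n : ℕ} (φ : Q.obj n →ₗ[R] R)
    (h : φ ∘ₗ Q.d n = 0) :
    extMap f n (Q.extClass φ h) = P.extClass (φ ∘ₗ a.map n) (by
      rw [LinearMap.comp_assoc, ← a.d_comp, ← LinearMap.comp_assoc, h, LinearMap.zero_comp]) :=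
  ProjectiveResolution.mk₀_comp_extMk _ _ _ _ a.toHom

end Lift

/-! ### The long exact sequence of `Ext(-, R)` -/

section Sequence

variable {X Y Z X' Y' Z' : Type u} [AddCommGroup X] [Module R X] [AddCommGroup Y] [Module R Y]
  [AddCommGroup Z] [Module R Z] [AddCommGroup X'] [Module R X'] [AddCommGroup Y'] [Module R Y']
  [AddCommGroup Z'] [Module R Z']

lemma extMap_comp (f : X →ₗ[R] Y) (g : Y →ₗ[R] Z) {n : ℕ}
    (e : Ext (ModuleCat.of R Z) (ModuleCat.of R R) n) :
    extMap f n (extMap g n e) = extMap (g ∘ₗ f) n e :=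
  Ext.mk₀_comp_mk₀_assoc _ _ _

lemma extMap_id {n : ℕ} (e : Ext (ModuleCat.of R X) (ModuleCat.of R R) n) :
    extMap LinearMap.id n e = e :=
  Ext.mk₀_id_comp e

lemma extMap_map_add (f g : X →ₗ[R] Y) {n : ℕ}
    (e : Ext (ModuleCat.of R Y) (ModuleCat.of R R) n) :
    extMap (f + g) n e = extMap f n e + extMap g n e := by
  unfold extMap
  rw [ModuleCat.ofHom_add, Ext.mk₀_add, Ext.add_comp]

lemma extMap_zero (f : X →ₗ[R] Y) (n : ℕ) : extMap f n 0 = 0 :=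
  Ext.comp_zero ..

lemma injective_extMap_iff (f : X →ₗ[R] Y) (n : ℕ) :
    Function.Injective (extMap f n) ↔ ∀ e, extMap f n e = 0 → e = 0 :=
  injective_iff_map_eq_zero
    ((Ext.mk₀ (ModuleCat.ofHom f)).precomp (ModuleCat.of R R) (zero_add n))

lemma ext_eq_zero_of_projective [Module.Projective R X] {n : ℕ}
    (e : Ext (ModuleCat.of R X) (ModuleCat.of R R) (n + 1)) : e = 0 :=
  Ext.eq_zero_of_projective e

lemma extMap_eq_zero_of_projective [Module.Projective R Y] (f : X →ₗ[R] Y) (g : Y →ₗ[R] Z) {n : ℕ}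
    (e : Ext (ModuleCat.of R Z) (ModuleCat.of R R) (n + 1)) :
    extMap (g ∘ₗ f) (n + 1) e = 0 := by
  rw [← extMap_comp, ext_eq_zero_of_projective (extMap g (n + 1) e), extMap_zero]

/-- The homomorphism `X → R` as an element of `Ext⁰(X, R)`. -/
noncomputable def ext₀ (h : X →ₗ[R] R) : Ext (ModuleCat.of R X) (ModuleCat.of R R) 0 :=
  Ext.mk₀ (ModuleCat.ofHom h)

lemma exists_ext₀_eq (e : Ext (ModuleCat.of R X) (ModuleCat.of R R) 0) :
    ∃ h : X →ₗ[R] R, ext₀ h = e := by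
  obtain ⟨h, rfl⟩ := (Ext.mk₀_bijective _ _).2 e
  exact ⟨h.hom, rfl⟩

lemma ext₀_injective : Function.Injective (ext₀ (R := R) (X := X)) := fun _ _ h =>
  ModuleCat.hom_ext_iff.1 ((Ext.mk₀_bijective _ _).1 h)

lemma extMap_ext₀ (f : X →ₗ[R] Y) (h : Y →ₗ[R] R) : extMap f 0 (ext₀ h) = ext₀ (h ∘ₗ f) :=
  Ext.mk₀_comp_mk₀ _ _

/-- A short exact sequence of modules. -/
structure IsShortExact (f : X →ₗ[R] Y) (g : Y →ₗ[R] Z) : Prop where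
  injective : Function.Injective f
  exact : Function.Exact f g
  surjective : Function.Surjective g

namespace IsShortExact

variable {f : X →ₗ[R] Y} {g : Y →ₗ[R] Z} (S : IsShortExact f g)

include S in
lemma shortExact : (ShortComplex.mk (ModuleCat.ofHom f) (ModuleCat.ofHom g)
    (by ext x; exact S.exact.apply_apply_eq_zero x)).ShortExact where
  exact := (ShortComplex.ShortExact.moduleCat_exact_iff_function_exact _).2 S.exact
  mono_f := (ModuleCat.mono_iff_injective _).2 S.injective
  epi_g := (ModuleCat.epi_iff_surjective _).2 S.surjective

/-- The connecting homomorphism `Extⁿ(X, R) → Extⁿ⁺¹(Z, R)`. -/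
noncomputable def δ (n : ℕ) (e : Ext (ModuleCat.of R X) (ModuleCat.of R R) n) :
    Ext (ModuleCat.of R Z) (ModuleCat.of R R) (n + 1) :=
  S.shortExact.extClass.comp e (add_comm 1 n)

lemma δ_eq_zero_iff {n : ℕ} (e : Ext (ModuleCat.of R X) (ModuleCat.of R R) n) :
    S.δ n e = 0 ↔ ∃ e', extMap f n e' = e := by
  refine ⟨fun h => Ext.contravariant_sequence_exact₁ S.shortExact _ e _ h, ?_⟩
  rintro ⟨e', rfl⟩
  exact S.shortExact.extClass_comp_assoc e'

lemma extMap_eq_zero_iff {n : ℕ} (e : Ext (ModuleCat.of R Z) (ModuleCat.of R R) (n + 1)) :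
    extMap g (n + 1) e = 0 ↔ ∃ e', S.δ n e' = e := by
  refine ⟨fun h => Ext.contravariant_sequence_exact₃ S.shortExact _ e h _, ?_⟩
  rintro ⟨e', rfl⟩
  exact S.shortExact.comp_extClass_assoc e' _

include S in
lemma exists_of_extMap_eq_zero {n : ℕ} (e : Ext (ModuleCat.of R Y) (ModuleCat.of R R) n)
    (h : extMap f n e = 0) : ∃ e', extMap g n e' = e :=
  Ext.contravariant_sequence_exact₂ S.shortExact _ e h

lemma δ_surjective [Module.Projective R Y] (n : ℕ) : Function.Surjective (S.δ n) := fun e =>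
  (S.extMap_eq_zero_iff e).1 (ext_eq_zero_of_projective _)

lemma δ_ext₀_eq_zero_iff (h : X →ₗ[R] R) :
    S.δ 0 (ext₀ h) = 0 ↔ ∃ h' : Y →ₗ[R] R, h' ∘ₗ f = h := by
  rw [S.δ_eq_zero_iff]
  constructor
  · rintro ⟨e, he⟩
    obtain ⟨h', rfl⟩ := exists_ext₀_eq e
    exact ⟨h', ext₀_injective ((extMap_ext₀ f h').symm.trans he)⟩
  · rintro ⟨h', rfl⟩
    exact ⟨ext₀ h', extMap_ext₀ f h'⟩

lemma extMap_δ {f' : X' →ₗ[R] Y'} {g' : Y' →ₗ[R] Z'} (S' : IsShortExact f' g')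
    (a : X →ₗ[R] X') (b : Y →ₗ[R] Y') (c : Z →ₗ[R] Z') (hab : b ∘ₗ f = f' ∘ₗ a)
    (hbc : c ∘ₗ g = g' ∘ₗ b) {n : ℕ} (e : Ext (ModuleCat.of R X') (ModuleCat.of R R) n) :
    extMap c (n + 1) (S'.δ n e) = S.δ n (extMap a n e) := by
  have h := ShortComplex.ShortExact.extClass_naturality S.shortExact S'.shortExact
    { τ₁ := ModuleCat.ofHom a
      τ₂ := ModuleCat.ofHom b
      τ₃ := ModuleCat.ofHom c
      comm₁₂ := ModuleCat.hom_ext hab.symm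
      comm₂₃ := ModuleCat.hom_ext hbc.symm }
  unfold extMap δ
  rw [← Ext.comp_assoc _ _ _ (zero_add 1) (add_comm 1 n) (by omega),
    ← Ext.comp_assoc _ _ _ (add_zero 1) (zero_add n) (by omega)]
  exact congrArg (fun z => Ext.comp z e (add_comm 1 n)) h.symm

end IsShortExact

end Sequence

/-! ### Functionals and the bidual kernel -/

section Modules

variable {X Y Z : Type u} [AddCommGroup X] [Module R X] [AddCommGroup Y] [Module R Y]
  [AddCommGroup Z] [Module R Z]

lemma exists_comp_eq_of_surjective {g : X →ₗ[R] Y} (hg : Function.Surjective g) (h : X →ₗ[R] Z)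
    (hh : ∀ x, g x = 0 → h x = 0) : ∃ k : Y →ₗ[R] Z, k ∘ₗ g = h := by
  refine ⟨(LinearMap.ker g).liftQ h hh ∘ₗ (g.quotKerEquivOfSurjective hg).symm.toLinearMap, ?_⟩
  ext x
  have : (g.quotKerEquivOfSurjective hg).symm (g x) = (LinearMap.ker g).mkQ x := by
    rw [LinearEquiv.symm_apply_eq]
    rfl
  rw [LinearMap.comp_apply, LinearMap.comp_apply, LinearEquiv.coe_coe, this]
  rfl

lemma exists_eval_eq [Module.IsReflexive R X] (θ : Module.Dual R (Module.Dual R X)) :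
    ∃ x : X, ∀ φ : Module.Dual R X, θ φ = φ x :=
  ⟨(Module.evalEquiv R X).symm θ, fun φ =>
    (LinearMap.congr_fun ((Module.evalEquiv R X).apply_symm_apply θ) φ).symm⟩

lemma eq_of_forall_dual_eq [Module.Projective R X] {x y : X}
    (h : ∀ φ : Module.Dual R X, φ x = φ y) : x = y :=
  Module.eval_apply_injective R (LinearMap.ext h)

/-- `f : X → Y` is injective on the kernel of the biduality map `X → X**`. -/
def InjectiveOnBidualKer (f : X →ₗ[R] Y) : Prop :=
  ∀ x : X, (∀ ξ : X →ₗ[R] R, ξ x = 0) → f x = 0 → x = 0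

/-- Functionals separate the points of a projective module, so any map to one kills the bidual
kernel. Conversely, finitely many generators of `X*` are the coordinates of a map `X → Rᵏ` whose
kernel is exactly the bidual kernel. -/
lemma isRepresentedByMono_iff [IsNoetherianRing R] [Module.Finite R X] (f : X →ₗ[R] Y) :
    IsRepresentedByMono f ↔ InjectiveOnBidualKer f := by
  constructor
  · rintro ⟨F, _, _, s, hs⟩ x hx hfx
    refine (injective_iff_map_eq_zero (f.prod s)).1 hs x (Prod.ext hfx ?_)
    exact eq_of_forall_dual_eq fun φ => (hx (φ ∘ₗ s)).trans (map_zero φ).symm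
  · intro h
    obtain ⟨k, π, hπ⟩ := Module.Finite.exists_fin' R (Module.Dual R X)
    refine ⟨ModuleCat.of R (Fin k → R), inferInstanceAs (Module.Finite R (Fin k → R)),
      inferInstanceAs (Module.Projective R (Fin k → R)),
      LinearMap.pi fun i => π (Pi.single i 1), ?_⟩
    refine (injective_iff_map_eq_zero (f.prod _)).2 fun x hx => ?_
    obtain ⟨hfx, hsx⟩ := Prod.ext_iff.1 hx
    refine h x (fun ξ => ?_) hfx
    obtain ⟨v, rfl⟩ := hπ ξ
    rw [LinearMap.pi_apply_eq_sum_univ π v, LinearMap.sum_apply]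
    refine Finset.sum_eq_zero fun i _ => ?_
    rw [LinearMap.smul_apply]
    have hi : π (fun j => if i = j then 1 else 0) x = 0 := by
      have := congrFun hsx i
      have hs : (fun j => if i = j then 1 else 0 : Fin k → R) = Pi.single i 1 := by
        funext j
        simp [Pi.single_apply, eq_comm]
      rwa [hs]
    rw [hi, smul_zero]

end Modules

/-! ### Functionals on transposes -/

namespace FGResolution

section TrSyz

variable {Z : ModuleCat.{u} R} (P : FGResolution Z)

lemma toTrSyz_surjective (n : ℕ) : Function.Surjective (P.toTrSyz n) := Submodule.mkQ_surjective _

lemma toTrSyz_eq_zero_iff (n : ℕ) (φ : Module.Dual R (P.obj (n + 1))) :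
    P.toTrSyz n φ = 0 ↔ ∃ χ, P.codiff n χ = φ :=
  Submodule.Quotient.mk_eq_zero _

lemma isShortExact_toTrSyz (n : ℕ) :
    IsShortExact (X := LinearMap.range (P.codiff n)) (LinearMap.range (P.codiff n)).subtype
      (P.toTrSyz n) where
  injective := Subtype.val_injective
  exact x := by
    rw [toTrSyz_eq_zero_iff]
    simp
  surjective := P.toTrSyz_surjective n

/-- By reflexivity of `Pₙ₊₁`, functionals on `Tr Ωⁿ Z` are evaluations at elements of `Ker ∂ₙ₊₁ = Im
∂ₙ₊₂`. Hence the bidual kernel of `Tr Ωⁿ Z` is cocycles modulo coboundaries, that is, `Extⁿ⁺¹(Z,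
R)`. -/
lemma eval_toTrSyz_eq_zero_iff (n : ℕ) (φ : Module.Dual R (P.obj (n + 1))) :
    (∀ ξ : P.TrSyz n →ₗ[R] R, ξ (P.toTrSyz n φ) = 0) ↔ φ ∘ₗ P.d (n + 1) = 0 := by
  constructor
  · intro h
    ext z
    have h' := h ((LinearMap.range (P.codiff n)).liftQ (Module.Dual.eval R _ (P.d (n + 1) z)) (by
      rintro _ ⟨χ, rfl⟩
      change χ (P.d n (P.d (n + 1) z)) = 0
      rw [(P.exact_d_d n).apply_apply_eq_zero, map_zero]))
    exact h'
  · intro h ξ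
    obtain ⟨q, hq⟩ := exists_eval_eq (ξ ∘ₗ P.toTrSyz n)
    have hdq : P.d n q = 0 := eq_of_forall_dual_eq (R := R) fun χ => by
      rw [map_zero]
      refine (hq (P.codiff n χ)).symm.trans ?_
      rw [LinearMap.comp_apply, (P.toTrSyz_eq_zero_iff n _).2 ⟨χ, rfl⟩, map_zero]
    obtain ⟨z, rfl⟩ := (P.exact_d_d n q).1 hdq
    exact (hq φ).trans (LinearMap.congr_fun h z)

end TrSyz

section Tr

variable {X : Type u} [AddCommGroup X] [Module R X] (P : FGResolution (ModuleCat.of R X))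

/-- An element `p` of `P₀` whose image in `X` is killed by every functional on `X` gives a
functional on the image of `P₀* → P₁*`. -/
lemma exists_functional_of_eval_eq_zero (p : P.obj 0) (hp : ∀ ξ : X →ₗ[R] R, ξ (P.aug p) = 0) :
    ∃ h : LinearMap.range (P.codiff 0) →ₗ[R] R, ∀ φ, h ((P.codiff 0).rangeRestrict φ) = φ p := by
  obtain ⟨h, hh⟩ := exists_comp_eq_of_surjective
    (Y := LinearMap.range (P.codiff 0)) (P.codiff 0).surjective_rangeRestrict
    (Module.Dual.eval R _ p) (by
      intro φ hφ
      obtain ⟨ξ, rfl⟩ := exists_comp_eq_of_surjective (Y := X) P.aug_surjective φ (by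
        intro x hx
        obtain ⟨y, rfl⟩ := (P.exact_d_aug x).1 hx
        exact LinearMap.congr_fun (congrArg Subtype.val hφ) y)
      exact hp ξ)
  exact ⟨h, fun φ => LinearMap.congr_fun hh φ⟩

lemma exists_of_functional (h : LinearMap.range (P.codiff 0) →ₗ[R] R) :
    ∃ p : P.obj 0, (∀ φ, h ((P.codiff 0).rangeRestrict φ) = φ p) ∧
      ∀ ξ : X →ₗ[R] R, ξ (P.aug p) = 0 := by
  obtain ⟨p, hp⟩ := exists_eval_eq (h ∘ₗ (P.codiff 0).rangeRestrict)
  refine ⟨p, hp, fun ξ => ?_⟩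
  refine (hp (ξ ∘ₗ P.aug)).symm.trans ?_
  have : (P.codiff 0).rangeRestrict (ξ ∘ₗ P.aug) = 0 := by
    ext y
    exact (congrArg ξ (P.exact_d_aug.apply_apply_eq_zero y)).trans (map_zero ξ)
  rw [LinearMap.comp_apply, this, map_zero]

/-- A functional on the image of `P₀* → P₁*` given by `p ∈ P₀` extends to `P₁*` exactly when
`p` vanishes in `X`. -/
lemma functional_extends_iff {h : LinearMap.range (P.codiff 0) →ₗ[R] R} {p : P.obj 0}
    (hp : ∀ φ, h ((P.codiff 0).rangeRestrict φ) = φ p) :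
    (∃ h' : Module.Dual R (P.obj 1) →ₗ[R] R,
      h' ∘ₗ (LinearMap.range (P.codiff 0)).subtype = h) ↔ P.aug p = 0 := by
  rw [P.exact_d_aug]
  constructor
  · rintro ⟨h', rfl⟩
    obtain ⟨q, hq⟩ := exists_eval_eq h'
    exact ⟨q, eq_of_forall_dual_eq fun φ => (hq (P.codiff 0 φ)).symm.trans (hp φ)⟩
  · rintro ⟨q, rfl⟩
    refine ⟨Module.Dual.eval R _ q, ?_⟩
    ext ⟨_, φ, rfl⟩
    exact (hp φ).symm

end Tr

end FGResolution

/-! ### `(T₁)` as injectivity on the bidual kernel -/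

section Transpose

variable {X Y : Type u} [AddCommGroup X] [Module R X] [AddCommGroup Y] [Module R Y]

/-- The map from the image of `Q₀* → Q₁*` to the image of `P₀* → P₁*` induced by a chain map. -/
noncomputable def LiftOf.rangeMap {f : X →ₗ[R] Y} {P : FGResolution (ModuleCat.of R X)}
    {Q : FGResolution (ModuleCat.of R Y)} (a : LiftOf f P Q) :
    LinearMap.range (Q.codiff 0) →ₗ[R] LinearMap.range (P.codiff 0) :=
  (a.map 1).dualMap.restrict (by
    rintro _ ⟨φ, rfl⟩
    refine ⟨φ ∘ₗ a.map 0, ?_⟩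
    change φ ∘ₗ a.map 0 ∘ₗ P.d 0 = φ ∘ₗ Q.d 0 ∘ₗ a.map 1
    rw [a.d_comp])

lemma LiftOf.rangeMap_rangeRestrict {f : X →ₗ[R] Y} {P : FGResolution (ModuleCat.of R X)}
    {Q : FGResolution (ModuleCat.of R Y)} (a : LiftOf f P Q) (φ : Module.Dual R (Q.obj 0)) :
    a.rangeMap ((Q.codiff 0).rangeRestrict φ) = (P.codiff 0).rangeRestrict (φ ∘ₗ a.map 0) := by
  apply Subtype.ext
  change φ ∘ₗ Q.d 0 ∘ₗ a.map 1 = φ ∘ₗ a.map 0 ∘ₗ P.d 0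
  rw [a.d_comp]

/-- `Ext¹(Tr X, R)` consists of the functionals on the image of `P₀* → P₁*` modulo those extending
to `P₁*`. Such a functional is evaluation at some `p ∈ P₀` with image in the bidual kernel of `X`,
and it extends exactly when `p` dies in `X`. Under this identification `Ext¹(Tr f, R)` is the
restriction of `f`. -/
lemma injective_extMap_tr_iff {f : X →ₗ[R] Y} {P : FGResolution (ModuleCat.of R X)}
    {Q : FGResolution (ModuleCat.of R Y)} (a : LiftOf f P Q) :
    Function.Injective (extMap a.tr 1) ↔ InjectiveOnBidualKer f := by
  have hδ : ∀ h : LinearMap.range (P.codiff 0) →ₗ[R] R,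
      extMap a.tr 1 ((P.isShortExact_toTrSyz 0).δ 0 (ext₀ h)) =
        (Q.isShortExact_toTrSyz 0).δ 0 (ext₀ (h ∘ₗ a.rangeMap)) := fun h => by
    rw [(Q.isShortExact_toTrSyz 0).extMap_δ (P.isShortExact_toTrSyz 0) a.rangeMap
      (a.map 1).dualMap a.tr rfl rfl, extMap_ext₀]
  have hp₀ : ∀ {h : LinearMap.range (P.codiff 0) →ₗ[R] R} {p : P.obj 0},
      (∀ φ, h ((P.codiff 0).rangeRestrict φ) = φ p) →
      ∀ φ, (h ∘ₗ a.rangeMap) ((Q.codiff 0).rangeRestrict φ) = φ (a.map 0 p) := by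
    intro h p hp φ
    rw [LinearMap.comp_apply, a.rangeMap_rangeRestrict, hp]
    rfl
  have haug : ∀ p, Q.aug (a.map 0 p) = f (P.aug p) := fun p => LinearMap.congr_fun a.aug_comp p
  rw [injective_extMap_iff]
  constructor
  · intro H x hx hfx
    obtain ⟨p, rfl⟩ := P.aug_surjective x
    obtain ⟨h, hp⟩ := P.exists_functional_of_eval_eq_zero p hx
    refine (P.functional_extends_iff hp).1 (((P.isShortExact_toTrSyz 0).δ_ext₀_eq_zero_iff h).1
      (H _ ?_))
    rw [hδ, IsShortExact.δ_ext₀_eq_zero_iff, Q.functional_extends_iff (hp₀ hp), haug, hfx]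
  · intro H e he
    obtain ⟨e, rfl⟩ := (P.isShortExact_toTrSyz 0).δ_surjective 0 e
    obtain ⟨h, rfl⟩ := exists_ext₀_eq e
    obtain ⟨p, hp, hx⟩ := P.exists_of_functional h
    rw [hδ, IsShortExact.δ_ext₀_eq_zero_iff, Q.functional_extends_iff (hp₀ hp), haug] at he
    rw [IsShortExact.δ_ext₀_eq_zero_iff, P.functional_extends_iff hp]
    exact H _ hx he

lemma satisfiesT_one_iff [IsNoetherianRing R] [Module.Finite R X] [Module.Finite R Y]
    (f : X →ₗ[R] Y) : SatisfiesT 1 f ↔ InjectiveOnBidualKer f := by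
  constructor
  · intro H
    obtain ⟨P⟩ := FGResolution.nonempty_of_finite (ModuleCat.of R X)
    obtain ⟨Q⟩ := FGResolution.nonempty_of_finite (ModuleCat.of R Y)
    obtain ⟨a⟩ := LiftOf.nonempty f P Q
    exact (injective_extMap_tr_iff a).1 ((H P Q a).2 le_rfl)
  · intro H P Q a
    exact ⟨fun i h₁ h₂ => absurd h₁ (not_le.2 h₂), fun _ => (injective_extMap_tr_iff a).2 H⟩

end Transpose

/-! ### Stable isomorphisms -/

section StableIso

variable {X Y F G : Type u} [AddCommGroup X] [Module R X] [AddCommGroup Y] [Module R Y]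
  [AddCommGroup F] [Module R F] [AddCommGroup G] [Module R G] [Module.Projective R F]
  [Module.Projective R G]

/-- A homomorphism which is invertible modulo homomorphisms factoring through projective modules
induces bijections on `Extⁿ(-, R)` for `n ≥ 1`. -/
lemma bijective_extMap_of_stably_invertible {s : X →ₗ[R] Y} {r : Y →ₗ[R] X} {i : X →ₗ[R] F}
    {k : F →ₗ[R] X} {j : Y →ₗ[R] G} {h : G →ₗ[R] Y} (hX : r ∘ₗ s + k ∘ₗ i = LinearMap.id)
    (hY : s ∘ₗ r + h ∘ₗ j = LinearMap.id) (n : ℕ) : Function.Bijective (extMap s (n + 1)) := by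
  constructor
  · rw [injective_extMap_iff]
    intro e he
    rw [← extMap_id e, ← hY, extMap_map_add, extMap_eq_zero_of_projective j h, ← extMap_comp, he,
      extMap_zero, add_zero]
  · intro e
    refine ⟨extMap r (n + 1) e, ?_⟩
    rw [extMap_comp]
    conv_rhs => rw [← extMap_id e, ← hX, extMap_map_add, extMap_eq_zero_of_projective i k, add_zero]

/-- The map between the first syzygies with respect to two projective covers `F → Z`, `G → Z`
induced by a map over `Z` is a stable isomorphism. -/
lemma bijective_extMap_restrict {Z : Type u} [AddCommGroup Z] [Module R Z] {π : F →ₗ[R] Z}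
    {ε : G →ₗ[R] Z} (hπ : Function.Surjective π) {s : F →ₗ[R] G} (hs : ∀ x, ε (s x) = π x)
    {I : Submodule R F} {N : Submodule R G} (hI : ∀ x, π x = 0 ↔ x ∈ I) (hN : ∀ x, ε x = 0 ↔ x ∈ N)
    (hIN : ∀ x ∈ I, s x ∈ N) (n : ℕ) : Function.Bijective (extMap (s.restrict hIN) (n + 1)) := by
  -- A lift `β` of `ε` in the other direction is an inverse up to `id - β ∘ s` and `id - s ∘ β`.
  -- These take values in the syzygies `I` and `N`, so the errors factor through `F` and `G`.
  obtain ⟨β, hβ⟩ := Module.projective_lifting_property π ε hπ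
  have hβ' : ∀ x, π (β x) = ε x := LinearMap.congr_fun hβ
  refine bijective_extMap_of_stably_invertible (r := β.restrict (p := N) (q := I) fun x hx => ?_)
    (i := I.subtype) (k := (LinearMap.id - β ∘ₗ s).codRestrict I fun x => ?_)
    (j := N.subtype) (h := (LinearMap.id - s ∘ₗ β).codRestrict N fun x => ?_) ?_ ?_ n
  · rw [← hI, hβ', hN]
    exact hx
  · ext x : 2
    exact add_sub_cancel (β (s x)) x.1
  · ext x : 2
    exact add_sub_cancel (s (β x)) x.1
  · rw [← hI, LinearMap.sub_apply, map_sub, LinearMap.comp_apply, hβ', hs, LinearMap.id_apply,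
      sub_self]
  · rw [← hN, LinearMap.sub_apply, map_sub, LinearMap.comp_apply, hs, hβ', LinearMap.id_apply,
      sub_self]

lemma injective_extMap_comp_iff {Z : Type u} [AddCommGroup Z] [Module R Z] (f : X →ₗ[R] Y)
    {g : Y →ₗ[R] Z} {n : ℕ} (hg : Function.Bijective (extMap g n)) :
    Function.Injective (extMap (g ∘ₗ f) n) ↔ Function.Injective (extMap f n) := by
  have : extMap (g ∘ₗ f) n = extMap f n ∘ extMap g n := by
    funext e
    exact (extMap_comp _ _ e).symm
  rw [this, Function.Injective.of_comp_iff' _ hg]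

end StableIso

/-! ### The sequence `0 → Ker → Tr Ωⁿ Z → Pₙ₊₂* → Tr Ωⁿ⁺¹ Z → 0` -/

namespace FGResolution

section Kernel

variable {Z : ModuleCat.{u} R} (P : FGResolution Z)

/-- The kernel of `Tr Ωⁿ Z → Pₙ₊₂*`. -/
noncomputable abbrev kerOfTrSyz (n : ℕ) : Submodule R (P.TrSyz n) := LinearMap.ker (P.ofTrSyz n)

lemma exact_ofTrSyz_toTrSyz (n : ℕ) :
    Function.Exact (P.ofTrSyz n) (P.toTrSyz (n + 1)) := by
  intro φ
  rw [toTrSyz_eq_zero_iff]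
  constructor
  · rintro ⟨χ, rfl⟩
    exact ⟨P.toTrSyz n χ, rfl⟩
  · rintro ⟨x, hx⟩
    obtain ⟨χ, rfl⟩ := P.toTrSyz_surjective n x
    exact ⟨χ, hx⟩

lemma isShortExact_kerOfTrSyz (n : ℕ) :
    IsShortExact (Z := LinearMap.range (P.ofTrSyz n)) (P.kerOfTrSyz n).subtype
      (P.ofTrSyz n).rangeRestrict where
  injective := Subtype.val_injective
  exact x := by
    rw [Submodule.coe_subtype, Subtype.range_coe]
    exact Subtype.ext_iff
  surjective := LinearMap.surjective_rangeRestrict _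

lemma isShortExact_rangeOfTrSyz (n : ℕ) :
    IsShortExact (X := LinearMap.range (P.ofTrSyz n)) (LinearMap.range (P.ofTrSyz n)).subtype
      (P.toTrSyz (n + 1)) where
  injective := Subtype.val_injective
  exact x := by
    rw [P.exact_ofTrSyz_toTrSyz n x, Submodule.coe_subtype, Subtype.range_coe]
    rfl
  surjective := P.toTrSyz_surjective (n + 1)

/-- Functionals on `Tr Ωⁿ Z` come from functionals on `Pₙ₊₂*`. -/
lemma exists_comp_ofTrSyz_eq (n : ℕ) (ξ : P.TrSyz n →ₗ[R] R) :
    ∃ θ : Module.Dual R (P.obj (n + 2)) →ₗ[R] R, θ ∘ₗ P.ofTrSyz n = ξ := by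
  obtain ⟨q, hq⟩ := exists_eval_eq (ξ ∘ₗ P.toTrSyz n)
  have hdq : P.d n q = 0 := eq_of_forall_dual_eq (R := R) fun χ => by
    rw [map_zero]
    refine (hq (P.codiff n χ)).symm.trans ?_
    rw [LinearMap.comp_apply, (P.toTrSyz_eq_zero_iff n _).2 ⟨χ, rfl⟩, map_zero]
  obtain ⟨z, rfl⟩ := (P.exact_d_d n q).1 hdq
  refine ⟨Module.Dual.eval R _ z, ?_⟩
  refine LinearMap.ext fun x => ?_
  obtain ⟨φ, rfl⟩ := P.toTrSyz_surjective n x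
  exact (hq φ).symm

/-- The obstruction is to extending a functional from the image of `Tr Z → P₂*` to `P₂*`; pulled
back to `Tr Z`, it already comes from `P₂*`. -/
lemma ext_one_TrSyz_one_eq_zero (e : Ext (ModuleCat.of R (P.TrSyz 1)) (ModuleCat.of R R) 1) :
    e = 0 := by
  obtain ⟨e, rfl⟩ := (P.isShortExact_rangeOfTrSyz 0).δ_surjective 0 e
  obtain ⟨h, rfl⟩ := exists_ext₀_eq e
  rw [IsShortExact.δ_ext₀_eq_zero_iff]
  obtain ⟨θ, hθ⟩ := P.exists_comp_ofTrSyz_eq 0 (h ∘ₗ (P.ofTrSyz 0).rangeRestrict)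
  refine ⟨θ, ?_⟩
  ext ⟨_, x, rfl⟩
  exact LinearMap.congr_fun hθ x

lemma injective_extMap_rangeRestrict_of_subsingleton (n m : ℕ)
    [Subsingleton (Ext (ModuleCat.of R (P.kerOfTrSyz n)) (ModuleCat.of R R) m)] :
    Function.Injective (extMap (Y := LinearMap.range (P.ofTrSyz n))
      (P.ofTrSyz n).rangeRestrict (m + 1)) := by
  rw [injective_extMap_iff]
  intro e he
  obtain ⟨e, rfl⟩ := ((P.isShortExact_kerOfTrSyz n).extMap_eq_zero_iff e).1 he
  rw [IsShortExact.δ_eq_zero_iff]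
  exact ⟨0, Subsingleton.elim _ _⟩

/-- Dimension shifting turns `Extⁿ⁺²(Tr Ωⁿ⁺² Z, R)` into `Extⁿ⁺¹` of the image of `Tr Ωⁿ⁺¹ Z`, which
embeds in `Extⁿ⁺¹(Tr Ωⁿ⁺¹ Z, R)` by the hypothesis on the kernel. -/
lemma ext_TrSyz_eq_zero (n : ℕ)
    (h : ∀ i, i < n →
      Subsingleton (Ext (ModuleCat.of R (P.kerOfTrSyz (i + 1))) (ModuleCat.of R R) i))
    (e : Ext (ModuleCat.of R (P.TrSyz (n + 1))) (ModuleCat.of R R) (n + 1)) : e = 0 := by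
  induction n with
  | zero => exact P.ext_one_TrSyz_one_eq_zero e
  | succ n ih =>
    obtain ⟨e, rfl⟩ := (P.isShortExact_rangeOfTrSyz (n + 1)).δ_surjective (n + 1) e
    rw [IsShortExact.δ_eq_zero_iff]
    have := h n (Nat.lt_succ_self n)
    refine ⟨0, P.injective_extMap_rangeRestrict_of_subsingleton (n + 1) n ?_⟩
    rw [extMap_zero, extMap_zero]
    exact (ih (fun i hi => h i (by omega)) _).symm

lemma extMap_subtype_kerOfTrSyz_eq_zero (n : ℕ)
    (h : ∀ i, i + 1 < n →
      Subsingleton (Ext (ModuleCat.of R (P.kerOfTrSyz (i + 1))) (ModuleCat.of R R) i))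
    (e : Ext (ModuleCat.of R (P.TrSyz n)) (ModuleCat.of R R) n) :
    extMap (P.kerOfTrSyz n).subtype n e = 0 := by
  -- In degree `0` the group need not vanish, but functionals on `Tr Z` factor through `P₂*` and so
  -- kill the kernel.
  cases n with
  | zero =>
    obtain ⟨ξ, rfl⟩ := exists_ext₀_eq e
    obtain ⟨θ, rfl⟩ := P.exists_comp_ofTrSyz_eq 0 ξ
    rw [extMap_ext₀, LinearMap.comp_assoc]
    have : P.ofTrSyz 0 ∘ₗ (P.kerOfTrSyz 0).subtype = 0 := by
      ext x : 1
      exact x.2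
    rw [this, LinearMap.comp_zero]
    unfold ext₀
    rw [ModuleCat.ofHom_zero, Ext.mk₀_zero]
  | succ n =>
    rw [P.ext_TrSyz_eq_zero n (fun i hi => h i (by omega)) e, extMap_zero]

/-- Injectivity makes the connecting map zero, so every class on the kernel is a restriction from
`Tr Ωⁿ Z`, and restrictions vanish. -/
lemma subsingleton_ext_kerOfTrSyz (n : ℕ)
    (hres : ∀ e : Ext (ModuleCat.of R (P.TrSyz n)) (ModuleCat.of R R) n,
      extMap (P.kerOfTrSyz n).subtype n e = 0)
    (hinj : Function.Injective (extMap (Y := LinearMap.range (P.ofTrSyz n))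
      (P.ofTrSyz n).rangeRestrict (n + 1))) :
    Subsingleton (Ext (ModuleCat.of R (P.kerOfTrSyz n)) (ModuleCat.of R R) n) := by
  refine subsingleton_of_forall_eq 0 fun e => ?_
  have h := (injective_extMap_iff _ _).1 hinj ((P.isShortExact_kerOfTrSyz n).δ n e)
    (((P.isShortExact_kerOfTrSyz n).extMap_eq_zero_iff _).2 ⟨e, rfl⟩)
  obtain ⟨e', rfl⟩ := (IsShortExact.δ_eq_zero_iff _ e).1 h
  exact hres e'

end Kernel

end FGResolution

/-! ### The maps `ψᵐ⁺¹'ᵐ` on bidual kernels -/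

namespace PsiStepLift

variable {M : Type u} [AddCommGroup M] [Module R M] {P : FGResolution (ModuleCat.of R M)} {m : ℕ}
  {Q : FGResolution (ModuleCat.of R (P.TrSyz m))}
  {Q' : FGResolution (ModuleCat.of R (P.TrSyz (m + 1)))} (g : PsiStepLift P Q Q')

lemma aug_start (φ : Module.Dual R (P.obj (m + 2))) : Q'.aug (g.start φ) = P.toTrSyz (m + 1) φ :=
  LinearMap.congr_fun g.aug_comp φ

/-- The map from the image of `Tr Ωᵐ M → Pₘ₊₂*` to the first syzygy of `Tr Ωᵐ⁺¹ M`. -/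
noncomputable def rangeToSyzygy : LinearMap.range (P.ofTrSyz m) →ₗ[R] LinearMap.ker Q'.aug :=
  g.start.restrict fun φ hφ => by
    rw [LinearMap.mem_ker, g.aug_start]
    exact (P.exact_ofTrSyz_toTrSyz m φ).2 hφ

lemma bijective_extMap_rangeToSyzygy (n : ℕ) :
    Function.Bijective (extMap (X := LinearMap.range (P.ofTrSyz m)) (Y := LinearMap.ker Q'.aug)
      g.rangeToSyzygy (n + 1)) :=
  bijective_extMap_restrict (P.toTrSyz_surjective (m + 1)) g.aug_start
    (I := LinearMap.range (P.ofTrSyz m)) (fun φ => P.exact_ofTrSyz_toTrSyz m φ)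
    (fun _ => Iff.rfl) _ n

/-- The chain map underlying `ψᵐ⁺¹'ᵐ` as a lift of a homomorphism from `Tr Ωᵐ M` to the first
syzygy of `Tr Ωᵐ⁺¹ M`. -/
noncomputable def liftOf :
    LiftOf (Y := LinearMap.ker Q'.aug) (g.rangeToSyzygy ∘ₗ (P.ofTrSyz m).rangeRestrict)
      Q Q'.syzygy where
  map := g.map
  aug_comp := by
    ext x : 1
    refine (Q'.syzygy_aug_apply (g.map 0 x)).trans (Subtype.ext ?_)
    exact LinearMap.congr_fun g.d_comp_zero x
  d_comp k := by
    rw [Q'.syzygy_d]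
    exact g.d_comp_succ k

lemma psi_toTrSyz (φ : Module.Dual R (Q'.obj (m + 2))) :
    g.psi (Q'.toTrSyz (m + 1) φ) = Q.toTrSyz m (φ ∘ₗ g.map (m + 1)) := rfl

/-- The bidual kernel of `Jₘ₊₁² M` is `Extᵐ⁺¹` of the first syzygy of `Tr Ωᵐ⁺¹ M`, and on cocycles
`ψᵐ⁺¹'ᵐ` is composition with a lift of `Tr Ωᵐ M → N → syzygy`, `N` being the image in `Pₘ₊₂*`. The
second arrow is a stable isomorphism and can be dropped. -/
lemma injectiveOnBidualKer_psi_iff :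
    InjectiveOnBidualKer g.psi ↔ Function.Injective
      (extMap (Y := LinearMap.range (P.ofTrSyz m)) (P.ofTrSyz m).rangeRestrict (m + 1)) := by
  rw [← injective_extMap_comp_iff (P.ofTrSyz m).rangeRestrict (g.bijective_extMap_rangeToSyzygy m),
    injective_extMap_iff]
  have hcoc : ∀ {φ : Module.Dual R (Q'.obj (m + 2))}, φ ∘ₗ Q'.d (m + 2) = 0 →
      φ ∘ₗ Q'.syzygy.d (m + 1) = 0 := fun h => by rwa [Q'.syzygy_d]
  have hzero : ∀ {φ : Module.Dual R (Q'.obj (m + 2))} (h : φ ∘ₗ Q'.d (m + 2) = 0),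
      Q'.syzygy.extClass (n := m + 1) φ (hcoc h) = 0 ↔ Q'.toTrSyz (m + 1) φ = 0 := fun h => by
    refine (Q'.syzygy.extClass_eq_zero_iff _ (hcoc h)).trans ?_
    rw [Q'.toTrSyz_eq_zero_iff, Q'.syzygy_d]
    rfl
  have hmap : ∀ {φ : Module.Dual R (Q'.obj (m + 2))} (h : φ ∘ₗ Q'.d (m + 2) = 0),
      extMap (Y := LinearMap.ker Q'.aug) (g.rangeToSyzygy ∘ₗ (P.ofTrSyz m).rangeRestrict) (m + 1)
        (Q'.syzygy.extClass (n := m + 1) φ (hcoc h)) = 0 ↔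
      g.psi (Q'.toTrSyz (m + 1) φ) = 0 := fun {φ} h => by
    rw [LiftOf.extMap_extClass g.liftOf φ (hcoc h)]
    refine (Q.extClass_eq_zero_iff _ _).trans ?_
    rw [g.psi_toTrSyz, Q.toTrSyz_eq_zero_iff]
    rfl
  constructor
  · intro H e he
    obtain ⟨φ, h, rfl⟩ := Q'.syzygy.exists_extClass_eq e
    have h' : φ ∘ₗ Q'.d (m + 2) = 0 := by rwa [Q'.syzygy_d] at h
    exact (hzero h').2 (H _ ((Q'.eval_toTrSyz_eq_zero_iff (m + 1) φ).2 h') ((hmap h').1 he))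
  · intro H x hx hgx
    obtain ⟨φ, rfl⟩ := Q'.toTrSyz_surjective (m + 1) x
    have h := (Q'.eval_toTrSyz_eq_zero_iff (m + 1) φ).1 hx
    exact (hzero h).1 (H _ ((hmap h).2 hgx))

end PsiStepLift

/-! ### The kernel of `Tr Ωⁿ Z → Pₙ₊₂*` as an `Ext` module -/

namespace FGResolution

section Cocycles

variable {Z : ModuleCat.{u} R} (P : FGResolution Z)

/-- Sending a cocycle to its class, as a linear map. -/
noncomputable def extClassₗ (n : ℕ) :
    LinearMap.ker (P.codiff n) →ₗ[R] Ext Z (ModuleCat.of R R) n where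
  toFun φ := P.extClass φ.1 φ.2
  map_add' φ ψ := P.extClass_add _ _ φ.2 ψ.2
  map_smul' r φ := P.extClass_smul r _ φ.2

/-- The projection from cocycles to the kernel of `Tr Ωⁿ Z → Pₙ₊₂*`. -/
noncomputable def cocyclesToKer (n : ℕ) :
    LinearMap.ker (P.codiff (n + 1)) →ₗ[R] P.kerOfTrSyz n :=
  (P.toTrSyz n).restrict fun _ h => h

lemma cocyclesToKer_surjective (n : ℕ) : Function.Surjective (P.cocyclesToKer n) := by
  rintro ⟨x, hx⟩
  obtain ⟨φ, rfl⟩ := P.toTrSyz_surjective n x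
  exact ⟨⟨φ, hx⟩, rfl⟩

lemma extClassₗ_surjective (n : ℕ) : Function.Surjective (P.extClassₗ n) := fun e => by
  obtain ⟨φ, h, rfl⟩ := P.exists_extClass_eq e
  exact ⟨⟨φ, h⟩, rfl⟩

lemma ker_cocyclesToKer (n : ℕ) :
    LinearMap.ker (P.cocyclesToKer n) = LinearMap.ker (P.extClassₗ (n + 1)) := by
  ext φ
  exact (Subtype.ext_iff.trans (P.toTrSyz_eq_zero_iff n φ.1)).trans
    (P.extClass_eq_zero_iff φ.1 φ.2).symm

/-- The kernel of `Tr Ωⁿ Z → Pₙ₊₂*` is `Extⁿ⁺¹(Z, R)`. -/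
noncomputable def kerOfTrSyzEquivExt (n : ℕ) :
    P.kerOfTrSyz n ≃ₗ[R] Ext Z (ModuleCat.of R R) (n + 1) :=
  ((P.cocyclesToKer n).quotKerEquivOfSurjective (P.cocyclesToKer_surjective n)).symm.trans
    ((Submodule.quotEquivOfEq _ _ (P.ker_cocyclesToKer n)).trans
      (LinearMap.quotKerEquivOfSurjective (M := LinearMap.ker (P.codiff (n + 1)))
        (P.extClassₗ (n + 1)) (P.extClassₗ_surjective (n + 1))))

end Cocycles

end FGResolution

/-! ### Finite length and depth -/

section FiniteLength

variable {X Y Z : Type u} [AddCommGroup X] [Module R X] [AddCommGroup Y] [Module R Y]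
  [AddCommGroup Z] [Module R Z]

lemma subsingleton_ext_of_linearEquiv (e : X ≃ₗ[R] Y) (n : ℕ)
    [Subsingleton (Ext (ModuleCat.of R X) (ModuleCat.of R R) n)] :
    Subsingleton (Ext (ModuleCat.of R Y) (ModuleCat.of R R) n) := by
  refine subsingleton_of_forall_eq 0 fun x => ?_
  rw [← extMap_id x, ← LinearEquiv.comp_symm e, ← extMap_comp,
    Subsingleton.elim (extMap (e : X →ₗ[R] Y) n x) 0, extMap_zero]

lemma subsingleton_ext_of_subsingleton [Subsingleton X] (n : ℕ) :
    Subsingleton (Ext (ModuleCat.of R X) (ModuleCat.of R R) n) := by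
  refine subsingleton_of_forall_eq 0 fun x => ?_
  rw [← extMap_id x, Subsingleton.elim (LinearMap.id (R := R) (M := X)) 0]
  unfold extMap
  rw [ModuleCat.ofHom_zero, Ext.mk₀_zero, Ext.zero_comp]

lemma IsShortExact.injective_extMap {f : X →ₗ[R] Y} {g : Y →ₗ[R] Z} (S : IsShortExact f g) (n : ℕ)
    (h : ∀ i, i + 1 = n → Subsingleton (Ext (ModuleCat.of R X) (ModuleCat.of R R) i)) :
    Function.Injective (extMap g n) := by
  rw [injective_extMap_iff]
  intro e he
  cases n with
  | zero =>
    obtain ⟨φ, rfl⟩ := exists_ext₀_eq e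
    have h0 : ext₀ (0 : Z →ₗ[R] R) = 0 := by
      unfold ext₀
      rw [ModuleCat.ofHom_zero, Ext.mk₀_zero]
    have h1 : ext₀ (φ ∘ₗ g) = ext₀ ((0 : Z →ₗ[R] R) ∘ₗ g) := by
      rw [← extMap_ext₀, he, ← extMap_ext₀, h0, extMap_zero]
    rw [← h0]
    exact congrArg ext₀ ((LinearMap.cancel_right S.surjective).1 (ext₀_injective h1))
  | succ n =>
    obtain ⟨e', rfl⟩ := (S.extMap_eq_zero_iff e).1 he
    have := h n rfl
    exact (S.δ_eq_zero_iff e').2 ⟨0, Subsingleton.elim _ _⟩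

lemma isShortExact_subtype_mkQ (N : Submodule R X) : IsShortExact N.subtype N.mkQ where
  injective := Subtype.val_injective
  exact x := by simp
  surjective := N.mkQ_surjective

variable [IsLocalRing R]

lemma nonempty_equiv_residueField [hX : IsSimpleModule R X] :
    Nonempty (IsLocalRing.ResidueField R ≃ₗ[R] X) := by
  obtain ⟨I, hI, ⟨e⟩⟩ := isSimpleModule_iff_quot_maximal.1 hX
  obtain rfl : I = IsLocalRing.maximalIdeal R := IsLocalRing.eq_maximalIdeal hI
  exact ⟨e.symm⟩

/-- Induction along a composition series: every factor is `k`, and `Extⁿ(-, R)` is exact in the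
middle. -/
lemma subsingleton_ext_of_isFiniteLength {n : ℕ}
    [hk : Subsingleton (Ext (ModuleCat.of R (IsLocalRing.ResidueField R)) (ModuleCat.of R R) n)]
    (hX : IsFiniteLength R X) : Subsingleton (Ext (ModuleCat.of R X) (ModuleCat.of R R) n) := by
  induction hX with
  | @of_subsingleton X =>
    exact subsingleton_ext_of_subsingleton n
  | @of_simple_quotient X _ _ N _ _ ih =>
    obtain ⟨e⟩ := nonempty_equiv_residueField (R := R) (X := X ⧸ N)
    have := subsingleton_ext_of_linearEquiv e n
    refine subsingleton_of_forall_eq 0 fun x => ?_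
    obtain ⟨y, rfl⟩ := (isShortExact_subtype_mkQ N).exists_of_extMap_eq_zero x
      (Subsingleton.elim _ _)
    rw [Subsingleton.elim y 0, extMap_zero]

/-- A nonzero `X` has a submodule `N` of finite length with `X / N ≅ k`. As `Extᵗ⁻¹(N, R) = 0` (no
condition when `t = 0`), `Extᵗ(k, R)` embeds in `Extᵗ(X, R)`. -/
lemma subsingleton_of_subsingleton_ext {t : ℕ}
    (hlt : ∀ i < t,
      Subsingleton (Ext (ModuleCat.of R (IsLocalRing.ResidueField R)) (ModuleCat.of R R) i))
    (ht : Nontrivial (Ext (ModuleCat.of R (IsLocalRing.ResidueField R)) (ModuleCat.of R R) t))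
    (hX : IsFiniteLength R X) [Subsingleton (Ext (ModuleCat.of R X) (ModuleCat.of R R) t)] :
    Subsingleton X := by
  cases hX with
  | of_subsingleton => assumption
  | @of_simple_quotient _ _ _ N _ hN =>
    obtain ⟨e⟩ := nonempty_equiv_residueField (R := R) (X := X ⧸ N)
    have hinj := (isShortExact_subtype_mkQ N).injective_extMap t fun i hi => by
      have := hlt i (by omega)
      exact subsingleton_ext_of_isFiniteLength hN
    have := hinj.subsingleton
    have := subsingleton_ext_of_linearEquiv e.symm t
    exact absurd ht (not_nontrivial _)

lemma subsingleton_ext_residueField_of_lt_depth {t : ℕ} (ht : depth R R = t) {i : ℕ} (hi : i < t) :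
    Subsingleton (Ext (ModuleCat.of R (IsLocalRing.ResidueField R)) (ModuleCat.of R R) i) := by
  rw [← not_nontrivial_iff_subsingleton]
  intro h
  have : depth R R ≤ i := sInf_le ⟨i, rfl, h⟩
  rw [ht, Nat.cast_le] at this
  omega

lemma nontrivial_ext_residueField_of_depth_eq {t : ℕ} (ht : depth R R = t) :
    Nontrivial (Ext (ModuleCat.of R (IsLocalRing.ResidueField R)) (ModuleCat.of R R) t) := by
  have hne : {a : ℕ∞ | ∃ i : ℕ, a = i ∧ Nontrivial (Ext (ModuleCat.of R
      (IsLocalRing.ResidueField R)) (ModuleCat.of R R) i)}.Nonempty := by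
    by_contra h
    rw [Set.not_nonempty_iff_eq_empty] at h
    unfold depth at ht
    rw [h, sInf_empty] at ht
    exact ENat.top_ne_natCast t ht
  obtain ⟨i, hi, h⟩ := csInf_mem hne
  rw [ENat.natCast_inj.1 (ht.symm.trans hi)]
  exact h

end FiniteLength

/-! ### The maps `ψⁿ` up to homotopy -/

namespace PsiLift

variable {M : Type u} [AddCommGroup M] [Module R M] {P : FGResolution (ModuleCat.of R M)} {n : ℕ}
  {Q : FGResolution (ModuleCat.of R (P.TrSyz n))}

/-- A family of maps `Pⱼ* → Qₖ`, `j + k = N`, commuting with the differentials and inducing zero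
on the augmentation is null-homotopic. -/
lemma exists_homotopy {Z : ModuleCat.{u} R} (Q : FGResolution Z) {N : ℕ}
    (w : ∀ j k, j + k = N → (Module.Dual R (P.obj j) →ₗ[R] Q.obj k))
    (haug : Q.aug ∘ₗ w N 0 rfl = 0)
    (hd : ∀ j k (h : j + (k + 1) = N),
      Q.d k ∘ₗ w j (k + 1) h = w (j + 1) k (by omega) ∘ₗ P.codiff j)
    (j k : ℕ) (h : j + k = N) :
    ∃ (s : Module.Dual R (P.obj (j + 1)) →ₗ[R] Q.obj k)
      (t : Module.Dual R (P.obj j) →ₗ[R] Q.obj (k + 1)),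
      w j k h = s ∘ₗ P.codiff j + Q.d k ∘ₗ t := by
  induction k generalizing j with
  | zero =>
    obtain rfl : j = N := h
    obtain ⟨t, ht⟩ := Module.projective_lifting_property (Q.d 0).rangeRestrict
      ((w j 0 rfl).codRestrict (LinearMap.range (Q.d 0)) fun x =>
        (Q.exact_d_aug _).1 (LinearMap.congr_fun haug x)) (LinearMap.surjective_rangeRestrict _)
    refine ⟨0, t, ?_⟩
    rw [LinearMap.zero_comp, zero_add]
    exact LinearMap.ext fun x => congrArg Subtype.val (LinearMap.congr_fun ht x).symm
  | succ k ih =>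
    obtain ⟨s, t, hst⟩ := ih (j + 1) (by omega)
    -- Corrected by the homotopy of the previous degree, `w` takes values in cycles, which lift
    -- since `Pⱼ*` is projective.
    have hker : Q.d k ∘ₗ (w j (k + 1) h - t ∘ₗ P.codiff j) = 0 := by
      rw [LinearMap.comp_sub, hd, hst, LinearMap.add_comp, LinearMap.comp_assoc,
        P.codiff_comp_codiff, LinearMap.comp_zero, zero_add, LinearMap.comp_assoc, sub_self]
    obtain ⟨t', ht'⟩ := Module.projective_lifting_property (Q.d (k + 1)).rangeRestrict
      ((w j (k + 1) h - t ∘ₗ P.codiff j).codRestrict (LinearMap.range (Q.d (k + 1))) fun x =>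
        (Q.exact_d_d k _).1 (LinearMap.congr_fun hker x)) (LinearMap.surjective_rangeRestrict _)
    refine ⟨t, t', ?_⟩
    rw [← sub_eq_iff_eq_add']
    exact LinearMap.ext fun x => congrArg Subtype.val (LinearMap.congr_fun ht' x).symm

lemma psi_toTrSyz_eq (f : PsiLift P Q) {φ : Module.Dual R (Q.obj (n + 1))} {p : P.obj 0}
    (hp : ∀ χ : Module.Dual R (P.obj 0), φ (f.map 0 (n + 1) (zero_add _) χ) = χ p) :
    f.psi (Q.toTrSyz n φ) = P.aug p := by
  change P.aug ((Module.evalEquiv R (P.obj 0)).symm (φ ∘ₗ f.map 0 (n + 1) (zero_add _))) = P.aug p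
  congr 1
  rw [LinearEquiv.symm_apply_eq]
  exact LinearMap.ext hp

/-- Two chain maps differ by a homotopy. The cocycle `φ` kills its part through the differential of
`Q`; the part through `P₁*` changes `p ∈ P₀` by a boundary, which is zero in `M`. -/
lemma psi_toTrSyz_eq_of_cocycle (f f' : PsiLift P Q) {φ : Module.Dual R (Q.obj (n + 1))}
    (hφ : φ ∘ₗ Q.d (n + 1) = 0) : f.psi (Q.toTrSyz n φ) = f'.psi (Q.toTrSyz n φ) := by
  obtain ⟨p, hp⟩ := exists_eval_eq (φ ∘ₗ f.map 0 (n + 1) (zero_add _))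
  obtain ⟨p', hp'⟩ := exists_eval_eq (φ ∘ₗ f'.map 0 (n + 1) (zero_add _))
  rw [f.psi_toTrSyz_eq hp, f'.psi_toTrSyz_eq hp', ← sub_eq_zero, ← map_sub]
  obtain ⟨s, t, hst⟩ := exists_homotopy Q (fun j k h => f.map j k h - f'.map j k h)
    (by rw [LinearMap.comp_sub, f.aug_comp, f'.aug_comp, sub_self])
    (fun j k h => by rw [LinearMap.comp_sub, f.d_comp, f'.d_comp, LinearMap.sub_comp])
    0 (n + 1) (zero_add _)
  obtain ⟨q, hq⟩ := exists_eval_eq (φ ∘ₗ s)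
  refine (P.exact_d_aug _).2 ⟨q, eq_of_forall_dual_eq (R := R) fun χ => ?_⟩
  rw [map_sub, ← hp, ← hp']
  have h₁ := congrArg φ (LinearMap.congr_fun hst χ)
  have h₂ : φ (Q.d (n + 1) (t χ)) = 0 := LinearMap.congr_fun hφ (t χ)
  simp only [LinearMap.sub_apply, LinearMap.add_apply, LinearMap.comp_apply, map_sub, map_add,
    h₂, add_zero] at h₁
  exact (hq (P.codiff 0 χ)).symm.trans h₁.symm

/-- `ψ⁰` is injective on the kernel of the biduality map. -/
lemma injectiveOnBidualKer_psi_zero {Q : FGResolution (ModuleCat.of R (P.TrSyz 0))}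
    (f : PsiLift P Q) : InjectiveOnBidualKer f.psi := by
  intro x hx hfx
  obtain ⟨φ, rfl⟩ := Q.toTrSyz_surjective 0 x
  have hφ : ∀ y, φ (Q.d 1 y) = 0 :=
    LinearMap.congr_fun ((Q.eval_toTrSyz_eq_zero_iff 0 φ).1 hx)
  obtain ⟨p, hp⟩ := exists_eval_eq (φ ∘ₗ f.map 0 1 rfl)
  rw [f.psi_toTrSyz_eq hp] at hfx
  obtain ⟨q, rfl⟩ := (P.exact_d_aug p).1 hfx
  have haug : ∀ χ, Q.aug (f.map 1 0 rfl χ) = P.toTrSyz 0 χ := LinearMap.congr_fun f.aug_comp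
  have hd : ∀ χ, Q.d 0 (f.map 0 1 rfl χ) = f.map 1 0 rfl (P.codiff 0 χ) :=
    LinearMap.congr_fun (f.d_comp 0 0 rfl)
  -- A comparison map backwards, `β : Q₀ → P₁*` and `β₁ : Q₁ → P₀*`; below, `h : Q₀ → Q₁` is the
  -- homotopy between the round trip on `Q₀` and the identity.
  obtain ⟨β, hβ⟩ := Module.projective_lifting_property (P.toTrSyz 0) Q.aug (P.toTrSyz_surjective 0)
  have hβ' : ∀ y, P.toTrSyz 0 (β y) = Q.aug y := LinearMap.congr_fun hβ
  obtain ⟨β₁, hβ₁⟩ := Module.projective_lifting_property (P.codiff 0).rangeRestrict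
    ((β ∘ₗ Q.d 0).codRestrict (LinearMap.range (P.codiff 0)) fun y =>
      (P.toTrSyz_eq_zero_iff 0 _).1 ((hβ' _).trans (Q.exact_d_aug.apply_apply_eq_zero y)))
    (LinearMap.surjective_rangeRestrict _)
  have hβ₁' : ∀ y, P.codiff 0 (β₁ y) = β (Q.d 0 y) := fun y =>
    congrArg Subtype.val (LinearMap.congr_fun hβ₁ y)
  obtain ⟨h, hh⟩ := Module.projective_lifting_property (Q.d 0).rangeRestrict
    ((f.map 1 0 rfl ∘ₗ β - LinearMap.id).codRestrict (LinearMap.range (Q.d 0)) fun y =>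
      (Q.exact_d_aug _).1 (by
        rw [LinearMap.sub_apply, map_sub, LinearMap.comp_apply, haug, hβ', LinearMap.id_apply,
          sub_self]))
    (LinearMap.surjective_rangeRestrict _)
  have hh' : ∀ y, Q.d 0 (h y) = f.map 1 0 rfl (β y) - y := fun y =>
    congrArg Subtype.val (LinearMap.congr_fun hh y)
  -- On `Q₁` the difference `f ∘ β₁ - id - h ∘ d` lands in boundaries, where `φ` vanishes, and `φ ∘
  -- f ∘ β₁` is evaluation of `β ∘ d` at `q`. Solving for `φ` gives this primitive.
  refine (Q.toTrSyz_eq_zero_iff 0 φ).2 ⟨Module.Dual.eval R _ q ∘ₗ β - φ ∘ₗ h, ?_⟩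
  refine LinearMap.ext fun y => ?_
  have h₁ : φ (f.map 0 1 rfl (β₁ y) - y - h (Q.d 0 y)) = 0 := by
    obtain ⟨z, hz⟩ := (Q.exact_d_d 0 (f.map 0 1 rfl (β₁ y) - y - h (Q.d 0 y))).1 (by
      rw [map_sub, map_sub, hd, hβ₁', hh', sub_self])
    rw [← hz]
    exact hφ z
  have h₂ : φ (f.map 0 1 rfl (β₁ y)) = β (Q.d 0 y) q := by
    rw [← hβ₁']
    exact hp (β₁ y)
  rw [map_sub, map_sub, h₂] at h₁
  change β (Q.d 0 y) q - φ (h (Q.d 0 y)) = φ y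
  rw [sub_right_comm, sub_eq_zero] at h₁
  exact h₁

end PsiLift

/-! ### Comparing `ψᵐ⁺¹` with `ψᵐ ∘ ψᵐ⁺¹'ᵐ` -/

namespace PsiStepLift

variable {M : Type u} [AddCommGroup M] [Module R M] {P : FGResolution (ModuleCat.of R M)} {m : ℕ}
  {Q : FGResolution (ModuleCat.of R (P.TrSyz m))}
  {Q' : FGResolution (ModuleCat.of R (P.TrSyz (m + 1)))}

/-- The chain map underlying the composite of `ψᵐ⁺¹'ᵐ` and `ψᵐ`. -/
noncomputable def compPsiLift (g : PsiStepLift P Q Q') (f : PsiLift P Q) : PsiLift P Q' where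
  map j k h := match k, h with
    | 0, h => Eq.rec (motive := fun i _ => Module.Dual R (P.obj i) →ₗ[R] Q'.obj 0) g.start h.symm
    | k + 1, h => g.map k ∘ₗ f.map j k (Nat.succ.inj h)
  aug_comp := g.aug_comp
  d_comp j k h := by
    cases k with
    | zero =>
      obtain rfl : j = m + 1 := by omega
      change Q'.d 0 ∘ₗ g.map 0 ∘ₗ f.map (m + 1) 0 rfl = g.start ∘ₗ P.codiff (m + 1)
      rw [← LinearMap.comp_assoc, g.d_comp_zero, LinearMap.comp_assoc, LinearMap.comp_assoc,
        f.aug_comp]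
      rfl
    | succ k =>
      change Q'.d (k + 1) ∘ₗ g.map (k + 1) ∘ₗ f.map j (k + 1) _ =
        (g.map k ∘ₗ f.map (j + 1) k _) ∘ₗ P.codiff j
      rw [← LinearMap.comp_assoc, g.d_comp_succ, LinearMap.comp_assoc, f.d_comp,
        LinearMap.comp_assoc]

lemma compPsiLift_psi (g : PsiStepLift P Q Q') (f : PsiLift P Q) (x : J Q') :
    (g.compPsiLift f).psi x = f.psi (g.psi x) := by
  obtain ⟨φ, rfl⟩ := Q'.toTrSyz_surjective (m + 1) x
  rfl

lemma psi_eq_psi_psi (g : PsiStepLift P Q Q') (f : PsiLift P Q) (f' : PsiLift P Q') {x : J Q'}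
    (hx : ∀ ξ : J Q' →ₗ[R] R, ξ x = 0) : f'.psi x = f.psi (g.psi x) := by
  rw [← g.compPsiLift_psi f]
  obtain ⟨φ, rfl⟩ := Q'.toTrSyz_surjective (m + 1) x
  exact f'.psi_toTrSyz_eq_of_cocycle _ ((Q'.eval_toTrSyz_eq_zero_iff (m + 1) φ).1 hx)

lemma injectiveOnBidualKer_psi_of_psiLift (g : PsiStepLift P Q Q') (f : PsiLift P Q)
    {f' : PsiLift P Q'} (hf' : InjectiveOnBidualKer f'.psi) : InjectiveOnBidualKer g.psi :=
  fun x hx hgx => hf' x hx (by rw [g.psi_eq_psi_psi f f' hx, hgx, map_zero])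

lemma injectiveOnBidualKer_psiLift {g : PsiStepLift P Q Q'} {f : PsiLift P Q}
    (f' : PsiLift P Q') (hg : InjectiveOnBidualKer g.psi) (hf : InjectiveOnBidualKer f.psi) :
    InjectiveOnBidualKer f'.psi := fun x hx hfx =>
  -- Homomorphisms preserve bidual kernels, so the hypothesis on `f` applies to the image of `x`.
  hg x hx (hf _ (fun ξ => hx (ξ ∘ₗ g.psi)) (by rw [← g.psi_eq_psi_psi f f' hx, hfx]))

end PsiStepLift

end StableModule

theorem mainTheorem7 {R : Type u} [CommRing R] [IsNoetherianRing R] [IsLocalRing R]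
    (t : ℕ) (ht : StableModule.depth R R = t)
    (M : Type u) [AddCommGroup M] [Module R M] [Module.Finite R M]
    (hM : ∀ i : ℕ, 1 ≤ i → i ≤ t →
      IsFiniteLength R (Ext (ModuleCat.of R M) (ModuleCat.of R R) i))
    -- arbitrary choices in the construction of the maps `ψ`
    (P : StableModule.FGResolution (ModuleCat.of R M))
    (Q : ∀ n : ℕ, StableModule.FGResolution (ModuleCat.of R (P.TrSyz n)))
    (f : ∀ n : ℕ, StableModule.PsiLift P (Q n))
    (g : ∀ m : ℕ, StableModule.PsiStepLift P (Q m) (Q (m + 1))) :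
    (∀ m : ℕ, m + 1 ≤ t →
      StableModule.SatisfiesT 1 (g m).psi ∧ StableModule.SatisfiesT 1 (f (m + 1)).psi) ∧
    (IsFiniteLength R (Ext (ModuleCat.of R M) (ModuleCat.of R R) (t + 1)) →
      [Subsingleton (Ext (ModuleCat.of R M) (ModuleCat.of R R) (t + 1)),
        StableModule.SatisfiesT 1 (g t).psi,
        StableModule.SatisfiesT 1 (f (t + 1)).psi,
        StableModule.IsRepresentedByMono (g t).psi,
        StableModule.IsRepresentedByMono (f (t + 1)).psi].TFAE) := by
  open StableModule in
  have hlt := fun i (hi : i < t) => subsingleton_ext_residueField_of_lt_depth ht hi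
  -- The kernel here is `Extᵐ⁺¹(M, R)`, of finite length, so its `Ext` into `R` vanishes below the
  -- depth.
  have hE : ∀ m i, m + 1 ≤ t → i < t →
      Subsingleton (Ext (ModuleCat.of R (P.kerOfTrSyz m)) (ModuleCat.of R R) i) := by
    intro m i hm hi
    have := hlt i hi
    exact subsingleton_ext_of_isFiniteLength
      ((P.kerOfTrSyzEquivExt m).symm.isFiniteLength (hM (m + 1) (by omega) hm))
  have hg : ∀ m, m + 1 ≤ t → InjectiveOnBidualKer (g m).psi := fun m hm => by
    have := hE m m hm hm
    exact (g m).injectiveOnBidualKer_psi_iff.2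
      (P.injective_extMap_rangeRestrict_of_subsingleton m m)
  have hf : ∀ m, m ≤ t → InjectiveOnBidualKer (f m).psi := by
    intro m hm
    induction m with
    | zero => exact (f 0).injectiveOnBidualKer_psi_zero
    | succ m ih =>
      exact PsiStepLift.injectiveOnBidualKer_psiLift (f (m + 1)) (hg m hm) (ih (by omega))
  refine ⟨fun m hm => ⟨(satisfiesT_one_iff _).2 (hg m hm), (satisfiesT_one_iff _).2 (hf _ hm)⟩,
    fun hlen => ?_⟩
  rw [isRepresentedByMono_iff, isRepresentedByMono_iff, satisfiesT_one_iff, satisfiesT_one_iff]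
  tfae_have 1 → 2 := fun h => by
    have := (P.kerOfTrSyzEquivExt t).toEquiv.subsingleton
    have := subsingleton_ext_of_subsingleton (R := R) (X := P.kerOfTrSyz t) t
    exact (g t).injectiveOnBidualKer_psi_iff.2
      (P.injective_extMap_rangeRestrict_of_subsingleton t t)
  tfae_have 2 → 1 := fun h => by
    -- Vanishing of the restriction uses only `Extⁱ(Extⁱ⁺²(M, R), R) = 0` with `i + 2 ≤ t`, the
    -- range of the standing hypothesis.
    have := P.subsingleton_ext_kerOfTrSyz t
      (P.extMap_subtype_kerOfTrSyz_eq_zero t fun i hi => hE (i + 1) i (by omega) (by omega))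
      ((g t).injectiveOnBidualKer_psi_iff.1 h)
    have := subsingleton_of_subsingleton_ext hlt (nontrivial_ext_residueField_of_depth_eq ht)
      ((P.kerOfTrSyzEquivExt t).symm.isFiniteLength hlen)
    exact (P.kerOfTrSyzEquivExt t).symm.toEquiv.subsingleton
  tfae_have 2 → 3 := fun h => PsiStepLift.injectiveOnBidualKer_psiLift (f (t + 1)) h (hf t le_rfl)
  tfae_have 3 → 2 := fun h => (g t).injectiveOnBidualKer_psi_of_psiLift (f t) h
  tfae_have 2 ↔ 4 := Iff.rfl
  tfae_have 3 ↔ 5 := Iff.rfl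
  tfae_finish
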